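/- Let $n\ge 0$, let $W(A_n)$ be the Coxeter group of type $A_n$ with generators $\sigma_1,\dots,\sigma_n$ ($\sigma_i\sigma_{i+1}$ of order $3$, $\sigma_i\sigma_j$ of order $2$ for $|i-j|>1$) and length function $\ell$. For $w\in W(A_n)$ let $\mathscr L(w)=\{\sigma_i : \ell(\sigma_i w)<\ell(w)\}$ and $\mathscr R(w)=\{\sigma_i : \ell(w\sigma_i)<\ell(w)\}$ be its left and right descent sets. Call $w$ fully commutative if any two reduced expressions of $w$ can be transformed into each other using only commutation relations $\sigma_i\sigma_j=\sigma_j\sigma_i$, $|i-j|>1$. For $1\le i\le j\le n$ put $[i,j]=\sigma_i\sigma_{i+1}\cdots\sigma_j$. (1) Let $w=[i_1,j_1][i_2,j_2]\cdots[i_p,j_p]$ with $p\ge 0$, $n\ge i_1>\dots>i_p\ge 1$, $n\ge j_1>\dots>j_p\ge 1$ and $i_t\le j_t$ for $1\le t\le p$ (by a known theorem of Stembridge, these are the canonical forms of the fully commutative elements of $W(A_n)$). Then $$\mathscr L(w)=\{\sigma_{i_1}\}\cup\{\sigma_{i_k} : 2\le k\le p,\ i_k<i_{k-1}-1\},\qquad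 \mathscr R(w)=\{\sigma_{j_p}\}\cup\{\sigma_{j_k} : 1\le k\le p-1,\ j_k>j_{k+1}+1\},$$ both sets being empty if $p=0$. (2) A non-crossing diagram on $n+1$ strings joins the dots of a top row $1,\dots,n+1$ and of a bottom row $1',\dots,(n+1)'$ of a rectangle in pairs, without crossings; the joins are called arrows. The concatenation $D_1*D_2$ is obtained by placing $D_2$ below $D_1$ and deleting the circles that arise. Let $E_i$ be the diagram with arrows $(i,i+1)$, $(i',(i+1)')$ and $(k,k')$ for $k\ne i,i+1$. For a fully commutative $w$ with reduced expression $w=\sigma_{k_1}\cdots\sigma_{k_r}$ let $\mathcal D(w)=E_{k_1}*\cdots*E_{k_r}$, the identity diagram (arrows $(k,k')$ for all $k$) if $r=0$; this is a non-crossing diagram and does not depend on the reduced expression. Then $$\mathscr L(w)=\{\sigma_i : (i,i+1)\text{ is an arrow of }\mathcal D(w)\},\qquad \mathscr R(w)=\{\sigma_i : (i',(i+1)')\text{ is an arrow of }\mathcal D(w)\}.$$ -/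

import Mathlib

namespace FCDiagram

/-! ### Fully commutative elements and descent sets of a Coxeter system -/

section Coxeter

variable {B : Type*} {M : CoxeterMatrix B} {W : Type*} [Group W]

/-- One application of a commutation relation `s t = t s` (where `m_{st} = 2`) to a word. -/
inductive CommutationStep (M : CoxeterMatrix B) : List B → List B → Prop
  | swap (l r : List B) (s t : B) (h : M s t = 2) :
      CommutationStep M (l ++ s :: t :: r) (l ++ t :: s :: r)

/-- `w` is fully commutative: one passes from any reduced expression of `w` to any other
by commutation relations only. -/
def IsFullyCommutative (cs : CoxeterSystem M W) (w : W) : Prop :=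
  ∀ ω ω' : List B, cs.IsReduced ω → cs.IsReduced ω' → cs.wordProd ω = w → cs.wordProd ω' = w →
    Relation.ReflTransGen (CommutationStep M) ω ω'

/-- The left descent set of `w`, as a set of (indices of) generators. -/
def leftDescents (cs : CoxeterSystem M W) (w : W) : Set B := {s | cs.IsLeftDescent w s}

/-- The right descent set of `w`, as a set of (indices of) generators. -/
def rightDescents (cs : CoxeterSystem M W) (w : W) : Set B := {s | cs.IsRightDescent w s}

end Coxeter

/-! ### Canonical forms in type `A_n`

The generator `σ_k`, `1 ≤ k ≤ n`, of `W(A_n)` is the simple reflection with index `k - 1 : Fin n`. -/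

/-- The word `[i, j] = σ_i σ_{i+1} ⋯ σ_j`. -/
def segment {n : ℕ} (i j : Fin n) : List (Fin n) :=
  (List.finRange n).filter fun k => i ≤ k ∧ k ≤ j

/-- The word `[i_1, j_1] [i_2, j_2] ⋯ [i_p, j_p]`. -/
def canonicalWord {n p : ℕ} (i j : Fin p → Fin n) : List (Fin n) :=
  (List.ofFn fun t => segment (i t) (j t)).flatten

/-- Standard `p`-pairs: `i_1 > ⋯ > i_p`, `j_1 > ⋯ > j_p` and `i_t ≤ j_t` for all `t`
(which forces `p ≤ n`). -/
structure IsStandard {n p : ℕ} (i j : Fin p → Fin n) : Prop where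
  anti_left : StrictAnti i
  anti_right : StrictAnti j
  le : ∀ t, i t ≤ j t

/-! ### Diagrams on `n + 1` strings -/

/-- The dots: a top row `1 < ⋯ < n+1` followed, in the total order,
by a bottom row `1' < ⋯ < (n+1)'`. -/
abbrev Dot (n : ℕ) : Type := Lex (Fin (n + 1) ⊕ Fin (n + 1))

/-- The `k`-th dot of the top row. -/
def top {n : ℕ} (k : Fin (n + 1)) : Dot n := toLex (Sum.inl k)

/-- The `k`-th dot of the bottom row. -/
def bot {n : ℕ} (k : Fin (n + 1)) : Dot n := toLex (Sum.inr k)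

/-- A diagram, as the set of its arrows `(x, y)`. -/
abbrev Arrows (n : ℕ) : Type := Set (Dot n × Dot n)

/-- The rank of a dot when one runs around the boundary of the rectangle: along the top row from
left to right, then along the bottom row from right to left. -/
def boundaryRank {n : ℕ} (d : Dot n) : ℕ :=
  Sum.elim (fun k : Fin (n + 1) => (k : ℕ)) (fun k : Fin (n + 1) => 2 * n + 1 - (k : ℕ)) (ofLex d)

/-- `r` lies strictly between the ranks of the two endpoints of the arrow `a`. -/
def RankBetween {n : ℕ} (a : Dot n × Dot n) (r : ℕ) : Prop :=
  min (boundaryRank a.1) (boundaryRank a.2) < r ∧ r < max (boundaryRank a.1) (boundaryRank a.2)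

/-- Non-crossing diagrams: arrows `(x, y)` satisfy `x < y`, each dot is an endpoint of exactly one
arrow, and no two arrows with four distinct endpoints cross, i.e. the endpoints of the second are
never separated, on the boundary of the rectangle, by those of the first. -/
structure IsNonCrossingDiagram {n : ℕ} (D : Arrows n) : Prop where
  lt : ∀ a ∈ D, a.1 < a.2
  existsUnique : ∀ d : Dot n, ∃! a, a ∈ D ∧ (a.1 = d ∨ a.2 = d)
  nonCrossing : ∀ a ∈ D, ∀ b ∈ D, a ≠ b →
    (RankBetween a (boundaryRank b.1) ↔ RankBetween a (boundaryRank b.2))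

/-- The identity diagram: arrows `(k, k')`. -/
def identity (n : ℕ) : Arrows n := {a | ∃ k, a = (top k, bot k)}

/-- The diagram `E_i`: arrows `(i, i+1)`, `(i', (i+1)')` and `(k, k')` for `k ≠ i, i+1`. -/
def E {n : ℕ} (i : Fin n) : Arrows n :=
  {(top i.castSucc, top i.succ), (bot i.castSucc, bot i.succ)} ∪
    {a | ∃ k, k ≠ i.castSucc ∧ k ≠ i.succ ∧ a = (top k, bot k)}

/-- Places the two rows of a diagram on the rows `r` and `r'` of a stack of three rows of dots. -/
def place {n : ℕ} (r r' : Fin 3) (d : Dot n) : Fin 3 × Fin (n + 1) :=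
  Sum.elim (fun k => (r, k)) (fun k => (r', k)) (ofLex d)

/-- The joins in the stack with `D₁` drawn between rows `0` and `1`, and `D₂` below it, between
rows `1` and `2`. -/
def StackJoin {n : ℕ} (D₁ D₂ : Arrows n) (u v : Fin 3 × Fin (n + 1)) : Prop :=
  (∃ a ∈ D₁, u = place 0 1 a.1 ∧ v = place 0 1 a.2) ∨
    (∃ a ∈ D₂, u = place 1 2 a.1 ∧ v = place 1 2 a.2)

/-- The concatenation `D₁ ∗ D₂`, with `D₂` placed below `D₁`: two dots of the outer rows are joined
when they are connected in the stack. Circles are deleted. -/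
def concat {n : ℕ} (D₁ D₂ : Arrows n) : Arrows n :=
  {a | a.1 < a.2 ∧ Relation.EqvGen (StackJoin D₁ D₂) (place 0 2 a.1) (place 0 2 a.2)}

/-- `E_{k_1} ∗ E_{k_2} ∗ ⋯ ∗ E_{k_r}`, from top to bottom, for a word `k_1 k_2 ⋯ k_r`. -/
def wordDiagram {n : ℕ} (ω : List (Fin n)) : Arrows n :=
  ω.foldr (fun i D => concat (E i) D) (identity n)

/-- The set `AD` of the arrows in the top row. -/
def topArrows {n : ℕ} (D : Arrows n) : Arrows n :=
  {a | a ∈ D ∧ ∃ x y, a = (top x, top y)}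

/-- The set `BD` of the arrows in the bottom row. -/
def bottomArrows {n : ℕ} (D : Arrows n) : Arrows n :=
  {a | a ∈ D ∧ ∃ x y, a = (bot x, bot y)}

/-- The diagram `𝒟(w)` of a fully commutative element `w` of `W(A_n)`: the concatenation of the
diagrams `E_k` along a reduced expression of `w`. -/
noncomputable def diagram {n : ℕ} {W : Type*} [Group W]
    (cs : CoxeterSystem (CoxeterMatrix.A n) W) (w : W) : Arrows n :=
  wordDiagram (cs.exists_isReduced w).choose

end FCDiagram

namespace FCDiagram

/-! ### Words in the integers -/

/-- The word `ω` contains `a`, and no `b` occurs in `ω` before the first `a`. -/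
def Precedes : List ℤ → ℤ → ℤ → Prop
  | [], _, _ => False
  | k :: ω, a, b => k = a ∨ (k ≠ b ∧ Precedes ω a b)

@[simp] theorem not_precedes_nil (a b : ℤ) : ¬ Precedes [] a b := id

@[simp] theorem precedes_cons (k : ℤ) (ω : List ℤ) (a b : ℤ) :
    Precedes (k :: ω) a b ↔ k = a ∨ (k ≠ b ∧ Precedes ω a b) := Iff.rfl

theorem Precedes.mem {ω : List ℤ} {a b : ℤ} (h : Precedes ω a b) : a ∈ ω := by
  induction ω with
  | nil => exact h.elim
  | cons k ω ih => grind [precedes_cons]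

theorem precedes_append (x y : List ℤ) (a b : ℤ) :
    Precedes (x ++ y) a b ↔ Precedes x a b ∨ (a ∉ x ∧ b ∉ x ∧ Precedes y a b) := by
  induction x with
  | nil => simp
  | cons k x ih =>
    simp only [List.cons_append, precedes_cons, ih, List.mem_cons, not_or]
    by_cases h : k = a
    · simp [h]
    · have h' : a ≠ k := fun e => h e.symm
      simp only [h, h', ne_eq, not_false_eq_true, true_and, false_or, eq_comm (a := b)]
      tauto

theorem precedes_iff_exists_append {ω : List ℤ} {a b : ℤ} :
    Precedes ω a b ↔ ∃ v x, ω = v ++ a :: x ∧ a ∉ v ∧ b ∉ v := by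
  constructor
  · intro h
    induction ω with
    | nil => exact h.elim
    | cons k ω ih =>
      by_cases hk : k = a
      · exact ⟨[], ω, by simp [hk]⟩
      · obtain ⟨hb, h⟩ := h.resolve_left hk
        obtain ⟨v, x, rfl, hv⟩ := ih h
        exact ⟨k :: v, x, rfl, by grind⟩
  · rintro ⟨v, x, rfl, h⟩
    simp [precedes_append, h]

theorem not_mem_or_precedes (ω : List ℤ) (a b : ℤ) :
    (a ∉ ω ∧ b ∉ ω) ∨ Precedes ω a b ∨ Precedes ω b a := by
  induction ω with
  | nil => simp
  | cons k ω ih => grind [precedes_cons]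

theorem precedes_iff_of_pairwise_lt {x : List ℤ} (hx : x.Pairwise (· < ·)) (a b : ℤ) :
    Precedes x a b ↔ a ∈ x ∧ (b ∈ x → a ≤ b) := by
  induction x with
  | nil => simp
  | cons k x ih =>
    rw [List.pairwise_cons] at hx
    have := ih hx.2
    have := hx.1 a
    have := hx.1 b
    grind [precedes_cons]

theorem precedes_map {f : ℤ → ℤ} (hf : Function.Injective f) (ω : List ℤ) (a b : ℤ) :
    Precedes (ω.map f) (f a) (f b) ↔ Precedes ω a b := by
  induction ω with
  | nil => simp
  | cons k ω ih => simp [ih, hf.eq_iff]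

theorem precedes_flatten_ofFn {p : ℕ} (L : Fin p → List ℤ) (a b : ℤ) :
    Precedes (List.ofFn L).flatten a b ↔
      ∃ t, Precedes (L t) a b ∧ ∀ u < t, a ∉ L u ∧ b ∉ L u := by
  induction p with
  | zero => simp
  | succ p ih =>
    rw [List.ofFn_succ, List.flatten_cons, precedes_append, ih]
    constructor
    · rintro (h | ⟨ha, hb, t, ht, hu⟩)
      · exact ⟨0, h, by simp⟩
      · refine ⟨t.succ, ht, fun u hut => ?_⟩
        cases u using Fin.cases with
        | zero => exact ⟨ha, hb⟩
        | succ u => exact hu u (Fin.succ_lt_succ_iff.1 hut)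
    · rintro ⟨t, ht, hu⟩
      cases t using Fin.cases with
      | zero => exact .inl ht
      | succ t =>
        refine .inr ⟨(hu 0 (Fin.succ_pos t)).1, (hu 0 (Fin.succ_pos t)).2, t, ht, fun u hut => ?_⟩
        exact hu u.succ (Fin.succ_lt_succ_iff.2 hut)

/-- Between two consecutive occurrences of `k`, both `k + 1` and `k - 1` occur. -/
def IsAlternating (ω : List ℤ) : Prop :=
  ∀ (u v x : List ℤ) (k j : ℤ), ω = u ++ k :: (v ++ k :: x) → j = k + 1 ∨ j = k - 1 →
    k ∉ v → j ∈ v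

theorem isAlternating_nil : IsAlternating [] := by
  intro u v x k j h
  simp at h

theorem isAlternating_cons {k : ℤ} {ω : List ℤ} :
    IsAlternating (k :: ω) ↔
      IsAlternating ω ∧ ¬ Precedes ω k (k + 1) ∧ ¬ Precedes ω k (k - 1) := by
  constructor
  · intro h
    refine ⟨fun u v x m j e => h (k :: u) v x m j (by simp [e]), ?_, ?_⟩ <;>
    · rw [precedes_iff_exists_append]
      rintro ⟨v, x, rfl, hk, hj⟩
      exact hj (h [] v x k _ rfl (by simp) hk)
  · rintro ⟨h, h1, h2⟩ u v x m j e hj hm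
    cases u with
    | cons a u =>
      obtain ⟨-, rfl⟩ := List.cons.inj e
      exact h u v x m j rfl hj hm
    | nil =>
      obtain ⟨rfl, rfl⟩ := List.cons.inj e
      by_contra hv
      rcases hj with rfl | rfl
      · exact h1 (precedes_iff_exists_append.2 ⟨v, x, rfl, hm, hv⟩)
      · exact h2 (precedes_iff_exists_append.2 ⟨v, x, rfl, hm, hv⟩)

theorem IsAlternating.reverse {ω : List ℤ} (h : IsAlternating ω) : IsAlternating ω.reverse := by
  intro u v x k j e hj hk
  have := h x.reverse v.reverse u.reverse k j ?_ hj (by simpa using hk)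
  · simpa using this
  · rw [← List.reverse_reverse ω, e]
    simp

theorem IsAlternating.append {x y : List ℤ} (hy : IsAlternating y)
    (h : ∀ u k v, x = u ++ k :: v →
      ¬ Precedes (v ++ y) k (k + 1) ∧ ¬ Precedes (v ++ y) k (k - 1)) :
    IsAlternating (x ++ y) := by
  induction x with
  | nil => exact hy
  | cons k x ih =>
    rw [List.cons_append, isAlternating_cons]
    exact ⟨ih fun u m v e => h (k :: u) m v (by simp [e]), h [] k x rfl⟩

/-- The integer word underlying a word in the generators. -/
def intWord {n : ℕ} (ω : List (Fin n)) : List ℤ := ω.map fun k : Fin n => ((k : ℕ) : ℤ)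

@[simp] theorem intWord_nil {n : ℕ} : intWord ([] : List (Fin n)) = [] := rfl

@[simp] theorem intWord_cons {n : ℕ} (k : Fin n) (ω : List (Fin n)) :
    intWord (k :: ω) = (k : ℤ) :: intWord ω := rfl

theorem intWord_append {n : ℕ} (ω ω' : List (Fin n)) :
    intWord (ω ++ ω') = intWord ω ++ intWord ω' := List.map_append

theorem intWord_reverse {n : ℕ} (ω : List (Fin n)) :
    intWord ω.reverse = (intWord ω).reverse := List.map_reverse

/-! ### Canonical words -/

theorem mem_intWord_segment {n : ℕ} {i j : Fin n} {a : ℤ} :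
    a ∈ intWord (segment i j) ↔ ((i : ℕ) : ℤ) ≤ a ∧ a ≤ ((j : ℕ) : ℤ) := by
  simp only [intWord, segment, List.mem_map, List.mem_filter, List.mem_finRange, true_and,
    decide_eq_true_eq]
  constructor
  · rintro ⟨k, hk, rfl⟩
    have h1 := Fin.le_def.1 hk.1
    have h2 := Fin.le_def.1 hk.2
    omega
  · rintro ⟨h1, h2⟩
    have := j.isLt
    refine ⟨(⟨a.toNat, by omega⟩ : Fin n), ?_, ?_⟩
    · simp only [Fin.le_def]; omega
    · simp; omega

theorem pairwise_intWord_segment {n : ℕ} (i j : Fin n) :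
    (intWord (segment i j)).Pairwise (· < ·) := by
  rw [intWord, List.pairwise_map]
  refine List.Pairwise.imp (R := (· < ·)) (fun h => by simpa using h) ?_
  exact (List.sortedLT_finRange n).pairwise.filter _

theorem intWord_canonicalWord {n p : ℕ} (i j : Fin p → Fin n) :
    intWord (canonicalWord i j) = (List.ofFn fun t => intWord (segment (i t) (j t))).flatten := by
  simp only [intWord, canonicalWord, List.map_flatten, List.map_ofFn]
  rfl

theorem IsStandard.precedes_sub_one_iff {n p : ℕ} {i j : Fin p → Fin n} (h : IsStandard i j)
    (a : ℤ) : Precedes (intWord (canonicalWord i j)) a (a - 1) ↔ ∃ t, ((i t : ℕ) : ℤ) = a := by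
  rw [intWord_canonicalWord, precedes_flatten_ofFn]
  simp only [precedes_iff_of_pairwise_lt (pairwise_intWord_segment _ _), mem_intWord_segment]
  constructor
  · rintro ⟨t, ht, -⟩
    exact ⟨t, by omega⟩
  · rintro ⟨t, rfl⟩
    have := Fin.le_def.1 (h.le t)
    refine ⟨t, by omega, fun u hu => ?_⟩
    have := Fin.lt_def.1 (h.anti_left hu)
    omega

theorem IsStandard.precedes_add_one_iff {n p : ℕ} {i j : Fin p → Fin n} (h : IsStandard i j)
    (t : Fin p) : Precedes (intWord (canonicalWord i j)) (i t : ℕ) ((i t : ℕ) + 1) ↔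
      ∀ u < t, ((i u : ℕ) : ℤ) ≠ (i t : ℕ) + 1 := by
  rw [intWord_canonicalWord, precedes_flatten_ofFn]
  simp only [precedes_iff_of_pairwise_lt (pairwise_intWord_segment _ _), mem_intWord_segment]
  have ht := Fin.le_def.1 (h.le t)
  constructor
  · rintro ⟨s, hs, hu⟩ u hut
    have h1 := Fin.lt_def.1 (h.anti_left hut)
    have h2 := Fin.le_def.1 (h.le u)
    rcases lt_or_ge u s with hus | hus
    · have := hu u hus
      omega
    · have := Fin.le_def.1 (h.anti_left.antitone hus)
      omega
  · intro hne
    refine ⟨t, by omega, fun u hu => ?_⟩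
    have := Fin.lt_def.1 (h.anti_left hu)
    have := hne u hu
    omega

theorem IsStandard.isAlternating {n p : ℕ} {i j : Fin p → Fin n} (h : IsStandard i j) :
    IsAlternating (intWord (canonicalWord i j)) := by
  induction p with
  | zero => simpa [canonicalWord] using isAlternating_nil
  | succ p ih =>
    have h' : IsStandard (fun t => i (Fin.succ t)) (fun t => j (Fin.succ t)) :=
      ⟨h.anti_left.comp_strictMono (Fin.strictMono_succ),
        h.anti_right.comp_strictMono (Fin.strictMono_succ), fun t => h.le _⟩
    have e : intWord (canonicalWord i j) = intWord (segment (i 0) (j 0)) ++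
        intWord (canonicalWord (fun t => i (Fin.succ t)) (fun t => j (Fin.succ t))) := by
      rw [← intWord_append, canonicalWord, List.ofFn_succ, List.flatten_cons]
      rfl
    rw [e]
    refine (ih h').append fun u k v huv => ?_
    have hk : k ∈ intWord (segment (i 0) (j 0)) := by simp [huv]
    have hp := pairwise_intWord_segment (i 0) (j 0)
    have hmem : ∀ a, a ∈ v ↔ k < a ∧ a ≤ ((j 0 : ℕ) : ℤ) := by
      intro a
      have ha := mem_intWord_segment (i := i 0) (j := j 0) (a := a)
      rw [mem_intWord_segment] at hk
      rw [huv, List.mem_append, List.mem_cons] at ha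
      rw [huv, List.pairwise_append, List.pairwise_cons] at hp
      have h1 := hp.2.1.1 a
      have h2 := fun hau => hp.2.2 a hau k (by simp)
      grind
    rw [mem_intWord_segment] at hk
    rw [precedes_append, precedes_append]
    have hkv : ∀ b, ¬ Precedes v k b := fun b hb => by
      have := (hmem k).1 hb.mem
      omega
    refine ⟨?_, ?_⟩
    · rintro (hb | ⟨-, h2, h3⟩)
      · exact hkv _ hb
      · have hm := h3.mem
        rw [intWord_canonicalWord, List.mem_flatten] at hm
        obtain ⟨l, hl, hkl⟩ := hm
        obtain ⟨t, rfl⟩ := (List.mem_ofFn' _ _).1 hl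
        rw [mem_intWord_segment] at hkl
        have := Fin.lt_def.1 (h.anti_right (Fin.succ_pos t))
        rw [hmem] at h2
        omega
    · rintro (hb | ⟨-, -, h3⟩)
      · exact hkv _ hb
      · obtain ⟨t, ht⟩ := (h'.precedes_sub_one_iff k).1 h3
        have := Fin.lt_def.1 (h.anti_left (Fin.succ_pos t))
        omega

theorem segment_reverse {n : ℕ} (i j : Fin n) :
    (segment i j).reverse = (segment j.rev i.rev).map Fin.rev := by
  rw [segment, segment, ← List.filter_reverse, List.finRange_reverse, List.filter_map]
  congr 1
  refine List.filter_congr fun k _ => ?_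
  simp only [Function.comp, Fin.le_def, Fin.val_rev]
  congr 1
  simp only [eq_iff_iff]
  omega

theorem reverse_ofFn {α : Type*} {p : ℕ} (f : Fin p → α) :
    (List.ofFn f).reverse = List.ofFn fun t => f t.rev := by
  refine List.ext_getElem (by simp) fun t h1 h2 => ?_
  simp only [List.getElem_reverse, List.getElem_ofFn, List.length_ofFn]
  congr 1
  ext
  simp only [Fin.val_rev]
  omega

theorem canonicalWord_reverse {n p : ℕ} (i j : Fin p → Fin n) :
    (canonicalWord i j).reverse =
      (canonicalWord (fun t => (j t.rev).rev) (fun t => (i t.rev).rev)).map Fin.rev := by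
  rw [canonicalWord, canonicalWord, List.reverse_flatten, List.map_flatten, List.map_ofFn,
    List.map_ofFn, reverse_ofFn]
  congr 2
  funext t
  simp [segment_reverse]

theorem intWord_map_rev {n : ℕ} (ω : List (Fin n)) :
    intWord (ω.map Fin.rev) = (intWord ω).map (((n : ℤ) - 1) - ·) := by
  simp only [intWord, List.map_map]
  refine List.map_congr_left fun k _ => ?_
  simp only [Function.comp, Fin.val_rev]
  omega

theorem IsStandard.rev {n p : ℕ} {i j : Fin p → Fin n} (h : IsStandard i j) :
    IsStandard (fun t => (j t.rev).rev) (fun t => (i t.rev).rev) where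
  anti_left _ _ hab := Fin.rev_lt_rev.2 (h.anti_right (Fin.rev_lt_rev.2 hab))
  anti_right _ _ hab := Fin.rev_lt_rev.2 (h.anti_left (Fin.rev_lt_rev.2 hab))
  le _ := Fin.rev_le_rev.2 (h.le _)

theorem precedes_reverse_canonicalWord {n p : ℕ} (i j : Fin p → Fin n)
    (a b : ℤ) : Precedes (intWord (canonicalWord i j).reverse) a b ↔
      Precedes (intWord (canonicalWord (fun t => (j t.rev).rev) (fun t => (i t.rev).rev)))
        (n - 1 - a) (n - 1 - b) := by
  rw [canonicalWord_reverse, intWord_map_rev,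
    ← precedes_map (f := ((n : ℤ) - 1 - ·)) sub_right_injective]
  simp [List.map_map]

theorem IsStandard.precedes_iff {n p : ℕ} {i j : Fin p → Fin n} (h : IsStandard i j)
    (s : Fin n) :
    Precedes (intWord (canonicalWord i j)) (s : ℕ) ((s : ℕ) + 1) ∧
      Precedes (intWord (canonicalWord i j)) (s : ℕ) ((s : ℕ) - 1) ↔
    s ∈ {s | ∃ k : Fin p, (k : ℕ) = 0 ∧ s = i k} ∪
      {s | ∃ k l : Fin p, (k : ℕ) = (l : ℕ) + 1 ∧
        ((i k : ℕ) : ℤ) < ((i l : ℕ) : ℤ) - 1 ∧ s = i k} := by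
  rw [h.precedes_sub_one_iff]
  simp only [Set.mem_union, Set.mem_ofPred_eq]
  constructor
  · rintro ⟨h1, t, ht⟩
    obtain rfl : i t = s := by ext; exact_mod_cast ht
    rw [h.precedes_add_one_iff] at h1
    rcases Nat.eq_zero_or_pos t with h0 | h0
    · exact .inl ⟨t, h0, rfl⟩
    · have hlt : (⟨t - 1, by omega⟩ : Fin p) < t := Fin.lt_def.2 (by simp; omega)
      have h2 := h1 _ hlt
      have h3 := Fin.lt_def.1 (h.anti_left hlt)
      exact .inr ⟨t, ⟨t - 1, by omega⟩, by simp; omega, by omega, rfl⟩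
  · rintro (⟨t, ht, rfl⟩ | ⟨t, l, htl, hi, rfl⟩)
    · refine ⟨(h.precedes_add_one_iff t).2 fun u hu => ?_, t, rfl⟩
      have := Fin.lt_def.1 hu
      omega
    · refine ⟨(h.precedes_add_one_iff t).2 fun u hu => ?_, t, rfl⟩
      have h2 : u ≤ l := Fin.le_def.2 (by have := Fin.lt_def.1 hu; omega)
      have h3 := Fin.le_def.1 (h.anti_left.antitone h2)
      omega

theorem IsStandard.precedes_reverse_iff {n p : ℕ} {i j : Fin p → Fin n} (h : IsStandard i j)
    (s : Fin n) :
    Precedes (intWord (canonicalWord i j).reverse) (s : ℕ) ((s : ℕ) + 1) ∧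
      Precedes (intWord (canonicalWord i j).reverse) (s : ℕ) ((s : ℕ) - 1) ↔
    s ∈ {s | ∃ k : Fin p, (k : ℕ) + 1 = p ∧ s = j k} ∪
      {s | ∃ k l : Fin p, (l : ℕ) = (k : ℕ) + 1 ∧
        ((j l : ℕ) : ℤ) + 1 < ((j k : ℕ) : ℤ) ∧ s = j k} := by
  have hs : (n : ℤ) - 1 - (s : ℕ) = (s.rev : ℕ) := by
    rw [Fin.val_rev]
    omega
  have h1 := h.rev.precedes_iff s.rev
  rw [precedes_reverse_canonicalWord, precedes_reverse_canonicalWord, and_comm, hs,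
    show (n : ℤ) - 1 - ((s : ℕ) - 1) = (s.rev : ℕ) + 1 by omega,
    show (n : ℤ) - 1 - ((s : ℕ) + 1) = (s.rev : ℕ) - 1 by omega, h1]
  simp only [Set.mem_union, Set.mem_ofPred_eq, Fin.rev_inj]
  refine or_congr ⟨?_, ?_⟩ ⟨?_, ?_⟩
  · rintro ⟨k, hk, rfl⟩
    exact ⟨k.rev, by rw [Fin.val_rev]; omega, rfl⟩
  · rintro ⟨k, hk, rfl⟩
    exact ⟨k.rev, by rw [Fin.val_rev]; omega, by rw [Fin.rev_rev]⟩
  · rintro ⟨k, l, hk, hj, rfl⟩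
    simp only [Fin.val_rev] at hj
    exact ⟨k.rev, l.rev, by simp only [Fin.val_rev]; omega, by omega, rfl⟩
  · rintro ⟨k, l, hk, hj, rfl⟩
    refine ⟨k.rev, l.rev, by simp only [Fin.val_rev]; omega, ?_, by rw [Fin.rev_rev]⟩
    simp only [Fin.rev_rev, Fin.val_rev]
    omega

/-! ### Words in a Coxeter group of type `A` -/

section TypeA

variable {n : ℕ} {W : Type*} [Group W] (cs : CoxeterSystem (CoxeterMatrix.A n) W)

theorem coxeterMatrix_A_apply (i j : Fin n) : CoxeterMatrix.A n i j =
    if i = j then 1 else if (j : ℕ) + 1 = i ∨ (i : ℕ) + 1 = j then 3 else 2 := rfl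

theorem coxeterMatrix_A_eq_two_iff {i j : Fin n} : CoxeterMatrix.A n i j = 2 ↔
    (i : ℕ) ≠ j ∧ (j : ℕ) + 1 ≠ i ∧ (i : ℕ) + 1 ≠ j := by
  rw [coxeterMatrix_A_apply]
  simp only [Fin.ext_iff]
  grind

theorem simple_mul_comm {i j : Fin n} (h : CoxeterMatrix.A n i j = 2) :
    cs.simple i * cs.simple j = cs.simple j * cs.simple i := by
  have := cs.simple_mul_simple_pow i j
  rw [h, pow_two, mul_eq_one_iff_eq_inv] at this
  simpa using this

theorem simple_braid {i j : Fin n} (h : (j : ℕ) + 1 = i ∨ (i : ℕ) + 1 = j) :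
    cs.simple i * cs.simple j * cs.simple i = cs.simple j * cs.simple i * cs.simple j := by
  have h3 : CoxeterMatrix.A n i j = 3 := by
    rw [coxeterMatrix_A_apply, if_neg, if_pos h]
    rintro rfl
    omega
  have := cs.simple_mul_simple_pow i j
  rw [h3, pow_succ, pow_two,
    show cs.simple i * cs.simple j * (cs.simple i * cs.simple j) * (cs.simple i * cs.simple j) =
      (cs.simple i * cs.simple j * cs.simple i) * (cs.simple j * cs.simple i * cs.simple j) by
      simp only [mul_assoc], mul_eq_one_iff_eq_inv] at this
  simpa [mul_assoc] using this

/-- The letter `s` can be moved to the front by commutations when it precedes its neighbours. -/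
theorem exists_perm_cons {ω : List (Fin n)} {s : Fin n}
    (h1 : Precedes (intWord ω) (s : ℕ) ((s : ℕ) + 1))
    (h2 : Precedes (intWord ω) (s : ℕ) ((s : ℕ) - 1)) :
    ∃ ω', ω.Perm (s :: ω') ∧ cs.wordProd ω = cs.wordProd (s :: ω') := by
  induction ω with
  | nil => exact h1.elim
  | cons k ω ih =>
    rw [intWord_cons, precedes_cons] at h1 h2
    by_cases hk : k = s
    · exact ⟨ω, by simp [hk]⟩
    · have hk' : ((k : ℕ) : ℤ) ≠ (s : ℕ) := by simpa [Fin.ext_iff] using hk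
      have h1 := h1.resolve_left hk'
      have h2 := h2.resolve_left hk'
      obtain ⟨ω', hp, e⟩ := ih h1.2 h2.2
      refine ⟨k :: ω', (hp.cons k).trans (List.Perm.swap _ _ _), ?_⟩
      have hc := simple_mul_comm cs (i := k) (j := s) (coxeterMatrix_A_eq_two_iff.2 (by omega))
      rw [cs.wordProd_cons, e, cs.wordProd_cons, cs.wordProd_cons, cs.wordProd_cons, ← mul_assoc,
        hc, mul_assoc]

theorem CommutationStep.perm {B : Type*} {M : CoxeterMatrix B} {ω ω' : List B}
    (h : CommutationStep M ω ω') : ω.Perm ω' := by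
  obtain ⟨l, r, s, t, -⟩ := h
  exact (List.Perm.swap _ _ _).append_left l

theorem perm_of_reflTransGen {B : Type*} {M : CoxeterMatrix B} {ω ω' : List B}
    (h : Relation.ReflTransGen (CommutationStep M) ω ω') : ω.Perm ω' := by
  induction h with
  | refl => exact .refl _
  | tail _ h ih => exact ih.trans h.perm

/-- If the first `k` of an alternating word `ω` is preceded by only one of the neighbours of `k`,
then the word `k :: ω` can be brought by commutations to a form with a factor `k j k`. -/
theorem exists_perm_braid {ω : List (Fin n)} {k : Fin n} {e : ℤ} (he : e = 1 ∨ e = -1)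
    (hω : IsAlternating (intWord ω))
    (h1 : Precedes (intWord ω) (k : ℕ) ((k : ℕ) + e))
    (h2 : Precedes (intWord ω) ((k : ℕ) - e) (k : ℕ)) :
    ∃ (u x : List (Fin n)) (j : Fin n), ((j : ℕ) + 1 = k ∨ (k : ℕ) + 1 = j) ∧
      (k :: ω).Perm (u ++ k :: j :: k :: x) ∧
      cs.wordProd (k :: ω) = cs.wordProd (u ++ k :: j :: k :: x) := by
  induction ω with
  | nil => exact h1.elim
  | cons m ω ih =>
    rw [intWord_cons, isAlternating_cons] at hω
    rw [intWord_cons, precedes_cons] at h1 h2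
    have hmk : ((m : ℕ) : ℤ) ≠ (k : ℕ) := by omega
    have h1 := h1.resolve_left hmk
    by_cases hm : ((m : ℕ) : ℤ) = (k : ℕ) - e
    · have hk2 : Precedes (intWord ω) (k : ℕ) ((k : ℕ) - e) := by
        have hn : ¬ Precedes (intWord ω) ((k : ℕ) - e) (k : ℕ) := by
          rcases he with rfl | rfl
          · have := hω.2.1
            rwa [hm, sub_add_cancel] at this
          · have := hω.2.2
            rwa [hm, sub_neg_eq_add, add_sub_cancel_right] at this
        have hmem := h1.2.mem
        rcases not_mem_or_precedes (intWord ω) (k : ℕ) ((k : ℕ) - e) with h | h | h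
        · exact absurd hmem h.1
        · exact h
        · exact absurd h hn
      obtain ⟨x, hp, hx⟩ : ∃ x, ω.Perm (k :: x) ∧ cs.wordProd ω = cs.wordProd (k :: x) := by
        rcases he with rfl | rfl
        · exact exists_perm_cons cs h1.2 hk2
        · rw [sub_neg_eq_add] at hk2
          exact exists_perm_cons cs hk2 h1.2
      refine ⟨[], x, m, by omega, (hp.cons m).cons k, ?_⟩
      rw [List.nil_append, cs.wordProd_cons, cs.wordProd_cons m, hx, ← cs.wordProd_cons,
        ← cs.wordProd_cons]
    · have h2 := h2.resolve_left hm
      obtain ⟨u, x, j, hj, hp, hx⟩ := ih hω.1 h1.2 h2.2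
      refine ⟨m :: u, x, j, hj, (List.Perm.swap _ _ _).trans (hp.cons m), ?_⟩
      have hc := simple_mul_comm cs (i := k) (j := m) (coxeterMatrix_A_eq_two_iff.2 (by omega))
      rw [List.cons_append, cs.wordProd_cons m, ← hx, cs.wordProd_cons, cs.wordProd_cons,
        cs.wordProd_cons, ← mul_assoc, hc, mul_assoc]

theorem not_isReduced_cons {ω : List (Fin n)} {k : Fin n}
    (h1 : Precedes (intWord ω) (k : ℕ) ((k : ℕ) + 1))
    (h2 : Precedes (intWord ω) (k : ℕ) ((k : ℕ) - 1)) : ¬ cs.IsReduced (k :: ω) := by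
  obtain ⟨x, hp, hx⟩ := exists_perm_cons cs h1 h2
  intro h
  have hl := cs.length_wordProd_le x
  have := hp.length_eq
  rw [CoxeterSystem.IsReduced, cs.wordProd_cons, hx, cs.wordProd_cons,
    cs.simple_mul_simple_cancel_left] at h
  simp only [List.length_cons] at h this
  omega

theorem not_isFullyCommutative_braid {u x : List (Fin n)} {j k : Fin n}
    (hj : (j : ℕ) + 1 = k ∨ (k : ℕ) + 1 = j)
    (hr : cs.IsReduced (u ++ k :: j :: k :: x)) :
    ¬ IsFullyCommutative cs (cs.wordProd (u ++ k :: j :: k :: x)) := by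
  intro h
  have e : cs.wordProd (u ++ j :: k :: j :: x) = cs.wordProd (u ++ k :: j :: k :: x) := by
    simp only [cs.wordProd_append, cs.wordProd_cons, ← mul_assoc]
    simp only [mul_assoc (cs.wordProd u)]
    rw [simple_braid cs (i := k) (j := j) hj]
  have hr' : cs.IsReduced (u ++ j :: k :: j :: x) := by
    rw [CoxeterSystem.IsReduced, e, hr.eq]
    simp
  have := (perm_of_reflTransGen (h _ _ hr hr' rfl e)).count_eq k
  have hne : j ≠ k := by
    rintro rfl
    omega
  simp [List.count_append, hne] at this

theorem isReduced_of_cons {ω : List (Fin n)} {k : Fin n} (h : cs.IsReduced (k :: ω)) :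
    cs.IsReduced ω := h.drop 1

/-- A reduced word such that no braid `m j m` can be produced in it is alternating. -/
theorem isAlternating_of_braidFree {ω : List (Fin n)} (h : cs.IsReduced ω)
    (hb : ∀ (u x : List (Fin n)) (j m : Fin n), (j : ℕ) + 1 = m ∨ (m : ℕ) + 1 = j →
      ω.Perm (u ++ m :: j :: m :: x) → cs.wordProd ω ≠ cs.wordProd (u ++ m :: j :: m :: x)) :
    IsAlternating (intWord ω) := by
  induction ω with
  | nil => exact isAlternating_nil
  | cons k ω ih =>
    have hω := ih (isReduced_of_cons cs h) fun u x j m hj hp e =>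
      hb (k :: u) x j m hj (hp.cons k) (by rw [List.cons_append, cs.wordProd_cons, e,
        cs.wordProd_cons])
    rw [intWord_cons, isAlternating_cons]
    have key : ∀ e : ℤ, e = 1 ∨ e = -1 → ¬ Precedes (intWord ω) (k : ℕ) ((k : ℕ) + e) := by
      intro e he h1
      rcases not_mem_or_precedes (intWord ω) (k : ℕ) ((k : ℕ) - e) with h2 | h2 | h2
      · exact h2.1 h1.mem
      · rcases he with rfl | rfl
        · exact not_isReduced_cons cs h1 h2 h
        · rw [sub_neg_eq_add] at h2
          exact not_isReduced_cons cs h2 h1 h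
      · obtain ⟨u, x, j, hj, hp, e⟩ := exists_perm_braid cs he hω h1 h2
        exact hb u x j k hj hp e
    exact ⟨hω, key 1 (.inl rfl), key (-1) (.inr rfl)⟩

theorem IsFullyCommutative.isAlternating {w : W} (hw : IsFullyCommutative cs w)
    {ω : List (Fin n)} (h : cs.IsReduced ω) (e : cs.wordProd ω = w) :
    IsAlternating (intWord ω) := by
  refine isAlternating_of_braidFree cs h fun u x j m hj hp e' => ?_
  refine not_isFullyCommutative_braid cs hj (u := u) (x := x) ?_ (by rwa [← e', e])
  rw [CoxeterSystem.IsReduced, ← e', h.eq, hp.length_eq]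

/-! ### The permutation representation -/

/-- The transposition exchanging `k` and `k + 1`. -/
def adjacentSwap (k : Fin n) : Equiv.Perm (Fin (n + 1)) := Equiv.swap k.castSucc k.succ

theorem isLiftable_adjacentSwap :
    (CoxeterMatrix.A n).IsLiftable (adjacentSwap : Fin n → Equiv.Perm (Fin (n + 1))) := by
  have h3 : ∀ a b c : Fin (n + 1), a ≠ b → a ≠ c → b ≠ c →
      (Equiv.swap a b * Equiv.swap a c) ^ 3 = 1 := fun a b c h1 h2 h3 => by
    rw [← (Equiv.Perm.isThreeCycle_swap_mul_swap_same h1 h2 h3).orderOf, pow_orderOf_eq_one]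
  intro i j
  rw [coxeterMatrix_A_apply]
  split_ifs with h1 h2
  · simp [h1, adjacentSwap]
  · rcases h2 with h2 | h2
    · have e : i.castSucc = j.succ := by ext; simp [← h2]
      rw [adjacentSwap, adjacentSwap, e, Equiv.swap_comm j.castSucc]
      refine h3 _ _ _ ?_ ?_ ?_ <;> simp [Fin.ext_iff] <;> omega
    · have e : i.succ = j.castSucc := by ext; simp [← h2]
      rw [adjacentSwap, adjacentSwap, e, Equiv.swap_comm i.castSucc]
      refine h3 _ _ _ ?_ ?_ ?_ <;> simp [Fin.ext_iff] <;> omega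
  · have hd : (adjacentSwap i).Disjoint (adjacentSwap j) := by
      rw [adjacentSwap, adjacentSwap]
      intro a
      by_cases ha : a = i.castSucc ∨ a = i.succ
      · right
        refine Equiv.swap_apply_of_ne_of_ne ?_ ?_ <;> rcases ha with rfl | rfl <;>
          simp [Fin.ext_iff] <;> omega
      · left
        exact Equiv.swap_apply_of_ne_of_ne (by tauto) (by tauto)
    rw [hd.commute.mul_pow]
    simp [adjacentSwap, pow_two]

/-- The inverse of the permutation of `w`. -/
noncomputable def invPerm (w : W) : Equiv.Perm (Fin (n + 1)) :=
  (cs.lift ⟨adjacentSwap, isLiftable_adjacentSwap⟩ w)⁻¹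

@[simp] theorem invPerm_one : invPerm cs 1 = 1 := by simp [invPerm]

theorem invPerm_simple_mul (k : Fin n) (w : W) :
    invPerm cs (cs.simple k * w) = invPerm cs w * adjacentSwap k := by
  rw [invPerm, map_mul, mul_inv_rev, cs.lift_apply_simple, invPerm]
  simp [adjacentSwap]

/-- The total displacement of a permutation. -/
def displacement (g : Equiv.Perm (Fin (n + 1))) : ℤ := ∑ a, |((g a : ℕ) : ℤ) - (a : ℕ)|

theorem displacement_mul_adjacentSwap (g : Equiv.Perm (Fin (n + 1))) (k : Fin n) :
    displacement (g * adjacentSwap k) = displacement g +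
      (|((g k.succ : ℕ) : ℤ) - (k : ℕ)| - |((g k.castSucc : ℕ) : ℤ) - (k : ℕ)| +
      (|((g k.castSucc : ℕ) : ℤ) - ((k : ℕ) + 1)| -
        |((g k.succ : ℕ) : ℤ) - ((k : ℕ) + 1)|)) := by
  rw [← sub_eq_iff_eq_add', displacement, displacement, ← Finset.sum_sub_distrib,
    Fintype.sum_eq_add k.castSucc k.succ (by simp [Fin.ext_iff])]
  · simp [adjacentSwap]
  · rintro a ⟨h1, h2⟩
    simp [adjacentSwap, Equiv.swap_apply_of_ne_of_ne h1 h2]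

theorem displacement_le (w : W) : displacement (invPerm cs w) ≤ 2 * cs.length w := by
  have key : ∀ ω : List (Fin n), displacement (invPerm cs (cs.wordProd ω)) ≤ 2 * ω.length := by
    intro ω
    induction ω with
    | nil => simp [displacement]
    | cons k ω ih =>
      rw [cs.wordProd_cons, invPerm_simple_mul, displacement_mul_adjacentSwap, List.length_cons]
      push_cast
      grind
  obtain ⟨ω, hr, rfl⟩ := cs.exists_isReduced w
  rw [hr.eq]
  exact key ω

/-- The position of `a` moves to the side of its first neighbouring letter. -/
theorem IsAlternating.invPerm {ω : List (Fin n)} (h : IsAlternating (intWord ω))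
    (a : Fin (n + 1)) :
    (Precedes (intWord ω) (a : ℕ) ((a : ℕ) - 1) → a < invPerm cs (cs.wordProd ω) a) ∧
    (Precedes (intWord ω) ((a : ℕ) - 1) (a : ℕ) → invPerm cs (cs.wordProd ω) a < a) ∧
    (((a : ℕ) : ℤ) ∉ intWord ω ∧ ((a : ℕ) : ℤ) - 1 ∉ intWord ω →
      invPerm cs (cs.wordProd ω) a = a) := by
  induction ω generalizing a with
  | nil => simp
  | cons k ω ih =>
    rw [intWord_cons, isAlternating_cons] at h
    have ih := ih h.1
    rw [cs.wordProd_cons, invPerm_simple_mul]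
    set g := FCDiagram.invPerm cs (cs.wordProd ω)
    simp only [intWord_cons, precedes_cons, List.mem_cons, not_or]
    by_cases h1 : a = k.castSucc
    · have h2 := ih k.succ
      have h3 := not_mem_or_precedes (intWord ω) (k : ℕ) ((k : ℕ) + 1)
      have e : (g * adjacentSwap k) a = g k.succ := by simp [adjacentSwap, h1]
      simp only [Fin.lt_def, Fin.ext_iff, Fin.val_succ, Nat.cast_add, Nat.cast_one,
        add_sub_cancel_right] at h2
      rw [e]
      subst h1
      simp only [Fin.lt_def, Fin.ext_iff, Fin.val_castSucc]
      grind
    · by_cases h2 : a = k.succ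
      · have h3 := ih k.castSucc
        have h4 := not_mem_or_precedes (intWord ω) (k : ℕ) ((k : ℕ) - 1)
        have e : (g * adjacentSwap k) a = g k.castSucc := by simp [adjacentSwap, h2]
        simp only [Fin.lt_def, Fin.ext_iff, Fin.val_castSucc] at h3
        rw [e]
        subst h2
        simp only [Fin.lt_def, Fin.ext_iff, Fin.val_succ]
        grind
      · have e : (g * adjacentSwap k) a = g a := by
          simp [adjacentSwap, Equiv.swap_apply_of_ne_of_ne h1 h2]
        have h3 := ih a
        rw [e]
        rw [Fin.ext_iff] at h1 h2
        simp only [Fin.val_castSucc, Fin.val_succ] at h1 h2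
        grind

theorem IsAlternating.displacement_eq {ω : List (Fin n)} (h : IsAlternating (intWord ω)) :
    displacement (FCDiagram.invPerm cs (cs.wordProd ω)) = 2 * ω.length := by
  induction ω with
  | nil => simp [displacement]
  | cons k ω ih =>
    rw [intWord_cons, isAlternating_cons] at h
    rw [cs.wordProd_cons, invPerm_simple_mul, displacement_mul_adjacentSwap, List.length_cons,
      ih h.1]
    have h2 := h.1.invPerm cs k.succ
    have h3 := h.1.invPerm cs k.castSucc
    have h4 := not_mem_or_precedes (intWord ω) (k : ℕ) ((k : ℕ) + 1)
    have h5 := not_mem_or_precedes (intWord ω) (k : ℕ) ((k : ℕ) - 1)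
    simp only [Fin.lt_def, Fin.ext_iff, Fin.val_castSucc, Fin.val_succ, Nat.cast_add, Nat.cast_one,
      add_sub_cancel_right] at h2 h3
    push_cast
    grind

theorem IsAlternating.isReduced {ω : List (Fin n)} (h : IsAlternating (intWord ω)) :
    cs.IsReduced ω := by
  have h1 := displacement_le cs (cs.wordProd ω)
  have h2 := cs.length_wordProd_le ω
  rw [h.displacement_eq cs] at h1
  rw [CoxeterSystem.IsReduced]
  omega

theorem IsAlternating.isLeftDescent_iff {ω : List (Fin n)} (h : IsAlternating (intWord ω))
    (s : Fin n) : cs.IsLeftDescent (cs.wordProd ω) s ↔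
      Precedes (intWord ω) (s : ℕ) ((s : ℕ) + 1) ∧
      Precedes (intWord ω) (s : ℕ) ((s : ℕ) - 1) := by
  constructor
  · intro hd
    have h1 := displacement_le cs (cs.simple s * cs.wordProd ω)
    rw [CoxeterSystem.IsLeftDescent, (h.isReduced cs).eq] at hd
    rw [invPerm_simple_mul, displacement_mul_adjacentSwap, h.displacement_eq] at h1
    have h2 := h.invPerm cs s.succ
    have h3 := h.invPerm cs s.castSucc
    have h4 := not_mem_or_precedes (intWord ω) (s : ℕ) ((s : ℕ) + 1)
    have h5 := not_mem_or_precedes (intWord ω) (s : ℕ) ((s : ℕ) - 1)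
    simp only [Fin.lt_def, Fin.ext_iff, Fin.val_castSucc, Fin.val_succ, Nat.cast_add, Nat.cast_one,
      add_sub_cancel_right] at h2 h3
    grind
  · rintro ⟨h1, h2⟩
    obtain ⟨x, hp, hx⟩ := exists_perm_cons cs h1 h2
    have hl := cs.length_wordProd_le x
    have := hp.length_eq
    rw [CoxeterSystem.IsLeftDescent, (h.isReduced cs).eq, hx, cs.wordProd_cons,
      cs.simple_mul_simple_cancel_left, this, List.length_cons]
    omega

theorem IsAlternating.isRightDescent_iff {ω : List (Fin n)} (h : IsAlternating (intWord ω))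
    (s : Fin n) : cs.IsRightDescent (cs.wordProd ω) s ↔
      Precedes (intWord ω.reverse) (s : ℕ) ((s : ℕ) + 1) ∧
      Precedes (intWord ω.reverse) (s : ℕ) ((s : ℕ) - 1) := by
  rw [← cs.isLeftDescent_inv_iff, ← cs.wordProd_reverse]
  refine IsAlternating.isLeftDescent_iff cs ?_ s
  rw [intWord_reverse]
  exact h.reverse

end TypeA

/-! ### Matchings -/

section Matching

variable {α : Type*}

/-- A perfect matching, as a fixed-point-free involution. -/
structure IsMatching (f : α → α) : Prop where
  invol : ∀ x, f (f x) = x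
  ne : ∀ x, f x ≠ x

variable [DecidableEq α]

/-- Joins `t` and `t'` to each other, and the former partners of `t` and `t'` to each other. -/
def rejoin (t t' : α) (f : α → α) (x : α) : α :=
  if x = t then t' else if x = t' then t else if f x = t then f t' else
    if f x = t' then f t else f x

theorem IsMatching.rejoin {f : α → α} (hf : IsMatching f) {t t' : α} (h : t ≠ t') :
    IsMatching (rejoin t t' f) where
  invol x := by
    have h1 := hf.invol x
    have h2 := hf.invol t
    have h3 := hf.invol t'
    have h4 := hf.ne t
    have h5 := hf.ne t'
    unfold FCDiagram.rejoin
    grind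
  ne x := by
    have h1 := hf.invol x
    have h2 := hf.invol t
    have h3 := hf.invol t'
    have h4 := hf.ne t
    have h5 := hf.ne x
    unfold FCDiagram.rejoin
    grind

theorem rejoin_comm {f : α → α} (hf : IsMatching f) {a a' b b' : α} (h1 : a ≠ b) (h2 : a ≠ b')
    (h3 : a' ≠ b) (h4 : a' ≠ b') (h5 : a ≠ a') (h6 : b ≠ b') :
    rejoin a a' (rejoin b b' f) = rejoin b b' (rejoin a a' f) := by
  funext x
  have i0 := hf.invol x
  have i1 := hf.invol a
  have i2 := hf.invol a'
  have i3 := hf.invol b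
  have i4 := hf.invol b'
  have n0 := hf.ne x
  have n1 := hf.ne a
  have n2 := hf.ne a'
  have n3 := hf.ne b
  have n4 := hf.ne b'
  unfold rejoin
  grind (splits := 30)

theorem rejoin_conj {σ : α → α} (hσ : ∀ x, σ (σ x) = x) (t t' : α) (f : α → α) :
    rejoin (σ t) (σ t') (fun x => σ (f (σ x))) = fun x => σ (rejoin t t' f (σ x)) := by
  have e : ∀ x y, σ x = y ↔ x = σ y := fun x y =>
    ⟨fun h => by rw [← h, hσ], fun h => by rw [h, hσ]⟩
  funext x
  simp only [rejoin, e, hσ]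
  split_ifs <;> simp_all

theorem rejoin_self {s : α → α} (hs : IsMatching s) {t t' : α} (h : s t ≠ t') :
    rejoin (s t) (s t') s = rejoin t t' s := by
  funext x
  have i0 := hs.invol x
  have i1 := hs.invol t
  have i2 := hs.invol t'
  have n1 := hs.ne t
  have n2 := hs.ne t'
  unfold rejoin
  grind

end Matching

/-! ### Diagrams as matchings -/

section Diagram

variable {n : ℕ}

theorem dot_cases (x : Dot n) : (∃ k, x = top k) ∨ ∃ k, x = bot k := by
  rcases h : ofLex x with k | k
  · exact .inl ⟨k, h⟩
  · exact .inr ⟨k, h⟩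

@[simp] theorem top_inj {a b : Fin (n + 1)} : top a = top b ↔ a = b :=
  ⟨fun h => Sum.inl_injective h, fun h => by rw [h]⟩

@[simp] theorem bot_inj {a b : Fin (n + 1)} : bot a = bot b ↔ a = b :=
  ⟨fun h => Sum.inr_injective h, fun h => by rw [h]⟩

@[simp] theorem top_ne_bot {a b : Fin (n + 1)} : top a ≠ bot b := fun h => Sum.inl_ne_inr h

@[simp] theorem bot_ne_top {a b : Fin (n + 1)} : bot a ≠ top b := fun h => Sum.inr_ne_inl h

theorem top_lt_top {a b : Fin (n + 1)} : top a < top b ↔ a < b := Sum.Lex.inl_lt_inl_iff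

theorem bot_lt_bot {a b : Fin (n + 1)} : bot a < bot b ↔ a < b := Sum.Lex.inr_lt_inr_iff

theorem top_lt_bot {a b : Fin (n + 1)} : top a < bot b := Sum.Lex.inl_lt_inr _ _

@[simp] theorem boundaryRank_top (k : Fin (n + 1)) : boundaryRank (top k) = k := rfl

@[simp] theorem boundaryRank_bot (k : Fin (n + 1)) : boundaryRank (bot k) = 2 * n + 1 - k := rfl

theorem boundaryRank_injective : Function.Injective (boundaryRank : Dot n → ℕ) := by
  intro x y h
  rcases dot_cases x with ⟨k, rfl⟩ | ⟨k, rfl⟩ <;> rcases dot_cases y with ⟨l, rfl⟩ | ⟨l, rfl⟩ <;>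
    simp [Fin.ext_iff] at * <;> omega

/-- The set of arrows of a matching. -/
def arrows (f : Dot n → Dot n) : Arrows n := {a | a.1 < a.2 ∧ f a.1 = a.2}

/-- The exchange of the two rows. -/
def flip (x : Dot n) : Dot n := toLex (ofLex x).swap

@[simp] theorem flip_top (k : Fin (n + 1)) : flip (top k) = bot k := rfl

@[simp] theorem flip_bot (k : Fin (n + 1)) : flip (bot k) = top k := rfl

@[simp] theorem flip_flip (x : Dot n) : flip (flip x) = x := by
  rcases dot_cases x with ⟨k, rfl⟩ | ⟨k, rfl⟩ <;> rfl

theorem isMatching_flip : IsMatching (flip : Dot n → Dot n) where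
  invol := flip_flip
  ne x := by rcases dot_cases x with ⟨k, rfl⟩ | ⟨k, rfl⟩ <;> simp

theorem identity_eq : identity n = arrows flip := by
  ext ⟨x, y⟩
  simp only [identity, arrows, Set.mem_ofPred_eq, Prod.mk.injEq]
  constructor
  · rintro ⟨k, rfl, rfl⟩
    exact ⟨top_lt_bot, rfl⟩
  · rintro ⟨h, rfl⟩
    rcases dot_cases x with ⟨k, rfl⟩ | ⟨k, rfl⟩
    · exact ⟨k, rfl, rfl⟩
    · exact absurd h top_lt_bot.not_gt

/-- The matching of `wordDiagram ω`. -/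
def wordMatching (ω : List (Fin n)) : Dot n → Dot n :=
  ω.foldr (fun k f => rejoin (top k.castSucc) (top k.succ) f) flip

@[simp] theorem wordMatching_nil : wordMatching ([] : List (Fin n)) = flip := rfl

@[simp] theorem wordMatching_cons (k : Fin n) (ω : List (Fin n)) :
    wordMatching (k :: ω) = rejoin (top k.castSucc) (top k.succ) (wordMatching ω) := rfl

theorem castSucc_ne_succ (k : Fin n) : k.castSucc ≠ k.succ := by simp [Fin.ext_iff]

theorem isMatching_wordMatching (ω : List (Fin n)) : IsMatching (wordMatching ω) := by
  induction ω with
  | nil => exact isMatching_flip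
  | cons k ω ih => exact ih.rejoin (by simpa using castSucc_ne_succ k)

/-! ### Concatenation -/

theorem eq_of_eqvGen {β γ : Type*} {r : β → β → Prop} (c : β → γ)
    (h : ∀ u v, r u v → c u = c v) {a b : β} (hab : Relation.EqvGen r a b) : c a = c b := by
  induction hab with
  | rel u v huv => exact h u v huv
  | refl => rfl
  | symm _ _ _ ih => exact ih.symm
  | trans _ _ _ _ _ ih1 ih2 => exact ih1.trans ih2

@[simp] theorem place_top (r r' : Fin 3) (k : Fin (n + 1)) : place r r' (top k) = (r, k) := rfl

@[simp] theorem place_bot (r r' : Fin 3) (k : Fin (n + 1)) : place r r' (bot k) = (r', k) := rfl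

variable {f : Dot n → Dot n} {i : Fin n}

theorem connected_of_rejoin (hf : IsMatching f) (x : Dot n) :
    Relation.EqvGen (StackJoin (E i) (arrows f)) (place 0 2 x)
      (place 0 2 (rejoin (top i.castSucc) (top i.succ) f x)) := by
  set r := StackJoin (E i) (arrows f)
  have h1 : ∀ x, x ≠ top i.castSucc → x ≠ top i.succ →
      Relation.EqvGen r (place 0 2 x) (place 1 2 x) := by
    intro x h h'
    rcases dot_cases x with ⟨k, rfl⟩ | ⟨k, rfl⟩
    · exact .rel _ _ (.inl ⟨(top k, bot k), .inr ⟨k, by simpa using h, by simpa using h', rfl⟩,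
        rfl, rfl⟩)
    · exact .refl _
  have h2 : ∀ x, Relation.EqvGen r (place 1 2 x) (place 1 2 (f x)) := by
    intro x
    rcases lt_or_gt_of_ne (hf.ne x) with h | h
    · exact .symm _ _ (.rel _ _ (.inr ⟨(f x, x), ⟨h, hf.invol x⟩, rfl, rfl⟩))
    · exact .rel _ _ (.inr ⟨(x, f x), ⟨h, rfl⟩, rfl, rfl⟩)
  have h3 : Relation.EqvGen r (place 1 2 (top i.castSucc)) (place 1 2 (top i.succ)) :=
    .rel _ _ (.inl ⟨(bot i.castSucc, bot i.succ), .inl (.inr rfl), rfl, rfl⟩)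
  have h4 : Relation.EqvGen r (place 0 2 (top i.castSucc)) (place 0 2 (top i.succ)) :=
    .rel _ _ (.inl ⟨(top i.castSucc, top i.succ), .inl (.inl rfl), rfl, rfl⟩)
  have i1 := hf.invol x
  have i2 := hf.invol (top i.castSucc)
  have i3 := hf.invol (top i.succ)
  have n1 := hf.ne (top i.castSucc)
  have n2 := hf.ne (top i.succ)
  unfold rejoin
  split_ifs with e1 e2 e3 e4
  · rw [e1]; exact h4
  · rw [e2]; exact h4.symm
  · have a := h2 x
    have b := h2 (top i.succ)
    rw [e3] at a
    exact ((((h1 x e1 e2).trans _ _ _ a).trans _ _ _ h3).trans _ _ _ b).trans _ _ _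
      (h1 _ (by grind) (by grind)).symm
  · have a := h2 x
    have b := h2 (top i.castSucc)
    rw [e4] at a
    exact ((((h1 x e1 e2).trans _ _ _ a).trans _ _ _ h3.symm).trans _ _ _ b).trans _ _ _
      (h1 _ (by grind) (by grind)).symm
  · exact ((h1 x e1 e2).trans _ _ _ (h2 x)).trans _ _ _ (h1 _ e3 e4).symm

theorem rejoin_of_connected (hf : IsMatching f) {x y : Dot n}
    (h : Relation.EqvGen (StackJoin (E i) (arrows f)) (place 0 2 x) (place 0 2 y))
    (hxy : x ≠ y) : rejoin (top i.castSucc) (top i.succ) f x = y := by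
  have htt : (top i.castSucc : Dot n) ≠ top i.succ := by simpa using castSucc_ne_succ i
  set t : Dot n := top i.castSucc with ht
  set t' : Dot n := top i.succ with ht'
  set g := rejoin t t' f with hg
  have hgm : IsMatching g := hf.rejoin htt
  have i2 := hf.invol t
  have i3 := hf.invol t'
  have n2 := hf.ne t
  have n3 := hf.ne t'
  have hA : ∀ x, x = t ∨ x = t' → f x = t ∨ f x = t' → g (f x) = f (f x) := fun x h h' => by
    rw [hg, rejoin]; grind
  have hB : ∀ x, ¬ (x = t ∨ x = t') → ¬ (f x = t ∨ f x = t') → g x = f x := fun x h h' => by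
    rw [hg, rejoin]; grind
  have hC : g t = t' := by rw [hg, rejoin, if_pos rfl]
  have hD : g (f t) = f t' := by rw [hg, rejoin]; grind
  let pair : Dot n → Set (Dot n) := fun x => {x, g x}
  have hpair : ∀ x, pair x = pair (g x) := fun x => by
    simp only [pair, hgm.invol, Set.pair_comm]
  have hpair' : ∀ x y, g x = y → pair x = pair y := fun x y e => e ▸ hpair x
  let q : Dot n → Set (Dot n) := fun x => if x = t ∨ x = t' then pair (f x) else pair x
  have hq : ∀ x, q x = q (f x) := by
    intro x
    have i1 := hf.invol x
    simp only [q]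
    split_ifs with a b b
    · exact hpair' _ _ (hA x a b)
    · rfl
    · rw [i1]
    · exact hpair' _ _ (hB x a b)
  let c : Fin 3 × Fin (n + 1) → Set (Dot n) := fun u =>
    if u.1 = 0 then pair (top u.2) else if u.1 = 1 then q (top u.2) else pair (bot u.2)
  have c02 : ∀ x, c (place 0 2 x) = pair x := by
    intro x
    rcases dot_cases x with ⟨k, rfl⟩ | ⟨k, rfl⟩ <;> simp [c]
  have c12 : ∀ x, c (place 1 2 x) = q x := by
    intro x
    rcases dot_cases x with ⟨k, rfl⟩ | ⟨k, rfl⟩ <;> simp [c, q, t, t']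
  have key : pair x = pair y := by
    rw [← c02, ← c02]
    refine eq_of_eqvGen c ?_ h
    rintro u v (⟨a, ha, rfl, rfl⟩ | ⟨a, ha, rfl, rfl⟩)
    · rcases ha with (rfl | rfl) | ⟨k, h1, h2, rfl⟩
      · exact hpair' _ _ hC
      · have : q t = q t' := by
          simp only [q, true_or, or_true, if_true]
          exact hpair' _ _ hD
        simpa [c] using this
      · have : q (top k) = pair (top k) := by simp [q, t, t', h1, h2]
        simp [c, this]
    · rw [c12, c12, ← ha.2]
      exact hq _
  have : y ∈ pair x := key ▸ Set.mem_insert _ _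
  rcases this with h | h
  · exact absurd h.symm hxy
  · exact h.symm

theorem concat_E_arrows (hf : IsMatching f) :
    concat (E i) (arrows f) = arrows (rejoin (top i.castSucc) (top i.succ) f) := by
  ext ⟨x, y⟩
  simp only [concat, arrows, Set.mem_ofPred_eq]
  refine and_congr_right fun hxy => ⟨fun h => rejoin_of_connected hf h hxy.ne, ?_⟩
  rintro rfl
  exact connected_of_rejoin hf x

theorem wordDiagram_eq (ω : List (Fin n)) : wordDiagram ω = arrows (wordMatching ω) := by
  induction ω with
  | nil => exact identity_eq
  | cons k ω ih =>
    have : wordDiagram (k :: ω) = concat (E k) (wordDiagram ω) := rfl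
    rw [this, ih, concat_E_arrows (isMatching_wordMatching ω), wordMatching_cons]

/-! ### Planarity -/

/-- The joins of the matching `f` do not cross. -/
def IsPlanar (f : Dot n → Dot n) : Prop :=
  ∀ x y, y ≠ x → y ≠ f x →
    (RankBetween (x, f x) (boundaryRank y) ↔ RankBetween (x, f x) (boundaryRank (f y)))

theorem isPlanar_flip : IsPlanar (flip : Dot n → Dot n) := by
  intro x y h1 h2
  rcases dot_cases x with ⟨k, rfl⟩ | ⟨k, rfl⟩ <;> rcases dot_cases y with ⟨l, rfl⟩ | ⟨l, rfl⟩ <;>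
    simp [RankBetween, Fin.ext_iff] at * <;> omega

theorem IsPlanar.rejoin (hf : IsMatching f) (hp : IsPlanar f) (i : Fin n) :
    IsPlanar (rejoin (top i.castSucc) (top i.succ) f) := by
  have htt : (top i.castSucc : Dot n) ≠ top i.succ := by simpa using castSucc_ne_succ i
  have hr : boundaryRank (top i.succ : Dot n) = boundaryRank (top i.castSucc : Dot n) + 1 := by
    simp
  set t : Dot n := top i.castSucc
  set t' : Dot n := top i.succ
  have hgm : IsMatching (FCDiagram.rejoin t t' f) := hf.rejoin htt
  have inj : ∀ {x y : Dot n}, x ≠ y → boundaryRank x ≠ boundaryRank y :=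
    fun h e => h (boundaryRank_injective e)
  have i2 := hf.invol t
  have i3 := hf.invol t'
  intro x y h1 h2
  have d1 := inj h1
  have d2 := inj h2
  have d3 := inj fun e : FCDiagram.rejoin t t' f y = x => h2 (by rw [← e, hgm.invol])
  have d4 := inj fun e : FCDiagram.rejoin t t' f y = FCDiagram.rejoin t t' f x =>
    h1 (by rw [← hgm.invol y, e, hgm.invol])
  have i0 := hf.invol x
  have i1 := hf.invol y
  have gt : FCDiagram.rejoin t t' f t = t' := if_pos rfl
  have gt' : FCDiagram.rejoin t t' f t' = t := by
    rw [FCDiagram.rejoin, if_neg htt.symm, if_pos rfl]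
  have gl : ∀ {z}, z ≠ t → z ≠ t' → f z = t → FCDiagram.rejoin t t' f z = f t' :=
    fun h h' e => by rw [FCDiagram.rejoin, if_neg h, if_neg h', if_pos e]
  have gr : ∀ {z}, z ≠ t → z ≠ t' → f z = t' → FCDiagram.rejoin t t' f z = f t :=
    fun h h' e => by rw [FCDiagram.rejoin, if_neg h, if_neg h', if_neg (e ▸ htt.symm), if_pos e]
  have go : ∀ {z}, z ≠ t → z ≠ t' → f z ≠ t → f z ≠ t' → FCDiagram.rejoin t t' f z = f z :=
    fun h h' e e' => by rw [FCDiagram.rejoin, if_neg h, if_neg h', if_neg e, if_neg e']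
  unfold IsPlanar RankBetween at hp
  unfold RankBetween
  simp only at hp ⊢
  by_cases xt : x = t
  · rw [xt, gt] at d2 d4 ⊢
    rw [xt] at d1 d3
    omega
  by_cases xt' : x = t'
  · rw [xt', gt'] at d2 d4 ⊢
    rw [xt'] at d1 d3
    omega
  by_cases yt : y = t
  · rw [yt, gt] at d3 d4 ⊢
    rw [yt] at d1 d2
    omega
  by_cases yt' : y = t'
  · rw [yt', gt'] at d3 d4 ⊢
    rw [yt'] at d1 d2
    omega
  have e1 := inj yt
  have e2 := inj yt'
  have e3 := inj xt
  have e4 := inj xt'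
  by_cases fxt : f x = t
  · rw [gl xt xt' fxt] at *
    have fyt : f y ≠ t := fun e => h1 (by rw [← i1, e, ← fxt, i0])
    have fyt' : f y ≠ t' := fun e => h2 (by rw [← i1, e])
    rw [go yt yt' fyt fyt'] at *
    have ftx : f t = x := by rw [← fxt, i0]
    have p1 := hp t y yt (by rwa [ftx])
    have p2 := hp t' y yt' h2
    have e5 := inj fyt
    have e6 := inj fyt'
    rw [ftx] at p1
    omega
  by_cases fxt' : f x = t'
  · rw [gr xt xt' fxt'] at *
    have fyt : f y ≠ t := fun e => h2 (by rw [← i1, e])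
    have fyt' : f y ≠ t' := fun e => h1 (by rw [← i1, e, ← fxt', i0])
    rw [go yt yt' fyt fyt'] at *
    have ftx : f t' = x := by rw [← fxt', i0]
    have p1 := hp t y yt h2
    have p2 := hp t' y yt' (by rwa [ftx])
    have e5 := inj fyt
    have e6 := inj fyt'
    rw [ftx] at p2
    omega
  rw [go xt xt' fxt fxt'] at *
  have e5 := inj fxt
  have e6 := inj fxt'
  have p1 := hp x y h1 h2
  by_cases fyt : f y = t
  · rw [gl yt yt' fyt] at *
    have p2 := hp x t' (Ne.symm xt') (Ne.symm fxt')
    rw [fyt] at p1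
    omega
  by_cases fyt' : f y = t'
  · rw [gr yt yt' fyt'] at *
    have p2 := hp x t (Ne.symm xt) (Ne.symm fxt)
    rw [fyt'] at p1
    omega
  rw [go yt yt' fyt fyt']
  exact p1

theorem isNonCrossingDiagram_arrows (hf : IsMatching f) (hp : IsPlanar f) :
    IsNonCrossingDiagram (arrows f) where
  lt _ ha := ha.1
  existsUnique d := by
    rcases lt_or_gt_of_ne (hf.ne d) with h | h
    · refine ⟨(f d, d), ⟨⟨h, hf.invol d⟩, .inr rfl⟩, ?_⟩
      rintro ⟨x, y⟩ ⟨⟨hxy, e⟩, hx⟩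
      simp only at hxy e hx
      rcases hx with rfl | rfl
      · exact absurd (e ▸ h) hxy.not_gt
      · rw [← e, hf.invol]
    · refine ⟨(d, f d), ⟨⟨h, rfl⟩, .inl rfl⟩, ?_⟩
      rintro ⟨x, y⟩ ⟨⟨hxy, e⟩, hx⟩
      simp only at hxy e hx
      rcases hx with rfl | rfl
      · rw [e]
      · rw [← e, hf.invol, e] at h
        exact absurd h hxy.not_gt
  nonCrossing := by
    rintro ⟨x, x'⟩ ⟨hx, e⟩ ⟨y, y'⟩ ⟨hy, e'⟩ hne
    simp only at hx hy e e'
    subst e e'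
    refine hp x y ?_ ?_
    · rintro rfl
      exact hne rfl
    · rintro rfl
      rw [hf.invol] at hy
      exact absurd hx hy.not_gt

theorem isPlanar_wordMatching (ω : List (Fin n)) : IsPlanar (wordMatching ω) := by
  induction ω with
  | nil => exact isPlanar_flip
  | cons k ω ih => exact ih.rejoin (isMatching_wordMatching ω) k

/-! ### Commutation and reversal -/

theorem CommutationStep.wordMatching_eq {ω ω' : List (Fin n)}
    (h : CommutationStep (CoxeterMatrix.A n) ω ω') : wordMatching ω = wordMatching ω' := by
  obtain ⟨l, r, s, t, h⟩ := h
  rw [coxeterMatrix_A_eq_two_iff] at h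
  simp only [wordMatching, List.foldr_append, List.foldr_cons]
  congr 1
  refine rejoin_comm (isMatching_wordMatching r) ?_ ?_ ?_ ?_ ?_ ?_ <;>
    simp [Fin.ext_iff] <;> omega

theorem wordMatching_eq_of_reflTransGen {ω ω' : List (Fin n)}
    (h : Relation.ReflTransGen (CommutationStep (CoxeterMatrix.A n)) ω ω') :
    wordMatching ω = wordMatching ω' := by
  induction h with
  | refl => rfl
  | tail _ h ih => exact ih.trans h.wordMatching_eq

theorem wordMatching_append_singleton (ω : List (Fin n)) (k : Fin n) :
    wordMatching (ω ++ [k]) = rejoin (bot k.castSucc) (bot k.succ) (wordMatching ω) := by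
  induction ω with
  | nil => exact (rejoin_self isMatching_flip (by simp)).symm
  | cons m ω ih =>
    rw [List.cons_append, wordMatching_cons, ih, wordMatching_cons]
    refine rejoin_comm (isMatching_wordMatching ω) ?_ ?_ ?_ ?_ ?_ ?_ <;> simp [Fin.ext_iff]

theorem wordMatching_reverse (ω : List (Fin n)) :
    wordMatching ω.reverse = fun x => flip (wordMatching ω (flip x)) := by
  induction ω with
  | nil => funext x; simp
  | cons k ω ih =>
    rw [List.reverse_cons, wordMatching_append_singleton, ih, wordMatching_cons,
      ← rejoin_conj flip_flip]
    rfl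

/-! ### Arrows of the top row -/

/-- An arrow of the top row leaves `a` on the side of the first letter among `a` and `a - 1`. -/
theorem IsAlternating.precedes_of_wordMatching {ω : List (Fin n)}
    (h : IsAlternating (intWord ω)) {a b : Fin (n + 1)} (hab : wordMatching ω (top a) = top b) :
    (a < b → Precedes (intWord ω) (a : ℕ) ((a : ℕ) - 1)) ∧
      (b < a → Precedes (intWord ω) ((a : ℕ) - 1) (a : ℕ)) := by
  induction ω generalizing a b with
  | nil => simp at hab
  | cons k ω ih =>
    rw [intWord_cons, isAlternating_cons] at h
    have ih := @ih h.1
    have hm := isMatching_wordMatching ω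
    rw [wordMatching_cons, rejoin] at hab
    simp only [intWord_cons, precedes_cons]
    simp only [top_inj] at hab
    simp only [Fin.lt_def] at ih ⊢
    split_ifs at hab with e1 e2 e3 e4
    · rw [top_inj] at hab
      subst hab e1
      simp only [Fin.val_castSucc, Fin.val_succ]
      grind
    · rw [top_inj] at hab
      subst hab e2
      simp only [Fin.val_castSucc, Fin.val_succ]
      grind
    · have h1 := ih e3
      have h2 := ih ((congrArg (wordMatching ω) e3).symm.trans (hm.invol _))
      have h3 := ih hab
      have hb : b ≠ k.succ := by
        rintro rfl
        exact hm.ne _ hab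
      simp only [Fin.ext_iff, Fin.val_castSucc, Fin.val_succ, Nat.cast_add, Nat.cast_one,
        add_sub_cancel_right] at *
      grind
    · have h1 := ih e4
      have h2 := ih ((congrArg (wordMatching ω) e4).symm.trans (hm.invol _))
      have h3 := ih hab
      have hb : b ≠ k.castSucc := by
        rintro rfl
        exact hm.ne _ hab
      simp only [Fin.ext_iff, Fin.val_castSucc, Fin.val_succ, Nat.cast_add, Nat.cast_one,
        add_sub_cancel_right] at *
      grind
    · have h1 := ih hab
      simp only [Fin.ext_iff, Fin.val_castSucc, Fin.val_succ] at *
      grind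

theorem IsAlternating.wordMatching_top_iff {ω : List (Fin n)}
    (h : IsAlternating (intWord ω)) (s : Fin n) :
    wordMatching ω (top s.castSucc) = top s.succ ↔
      Precedes (intWord ω) (s : ℕ) ((s : ℕ) + 1) ∧
      Precedes (intWord ω) (s : ℕ) ((s : ℕ) - 1) := by
  constructor
  · intro hs
    have hs' := (congrArg (wordMatching ω) hs).symm.trans
      ((isMatching_wordMatching ω).invol _)
    have h1 := (h.precedes_of_wordMatching hs).1 (by simp [Fin.lt_def])
    have h2 := (h.precedes_of_wordMatching hs').2 (by simp [Fin.lt_def])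
    simp only [Fin.val_castSucc, Fin.val_succ, Nat.cast_add, Nat.cast_one,
      add_sub_cancel_right] at h1 h2
    exact ⟨h2, h1⟩
  · clear h
    rintro ⟨h1, h2⟩
    induction ω with
    | nil => exact h1.elim
    | cons k ω ih =>
      rw [intWord_cons, precedes_cons] at h1 h2
      rw [wordMatching_cons, rejoin]
      by_cases hk : k = s
      · simp [hk]
      · have hk' : ((k : ℕ) : ℤ) ≠ (s : ℕ) := by simpa [Fin.ext_iff] using hk
        have h1 := h1.resolve_left hk'
        have h2 := h2.resolve_left hk'
        rw [ih h1.2 h2.2]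
        simp only [top_inj, Fin.ext_iff, Fin.val_castSucc, Fin.val_succ]
        rw [if_neg (by omega), if_neg (by omega), if_neg (by omega), if_neg (by omega)]

end Diagram

end FCDiagram

theorem mainTheorem9 (n : ℕ) {W : Type*} [Group W]
    (cs : CoxeterSystem (CoxeterMatrix.A n) W) :
    -- descent sets from the canonical form
    (∀ (p : ℕ) (i j : Fin p → Fin n), FCDiagram.IsStandard i j →
      ∀ w : W, w = cs.wordProd (FCDiagram.canonicalWord i j) →
        FCDiagram.leftDescents cs w =
            {s | ∃ k : Fin p, (k : ℕ) = 0 ∧ s = i k} ∪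
            {s | ∃ k l : Fin p, (k : ℕ) = (l : ℕ) + 1 ∧
              ((i k : ℕ) : ℤ) < ((i l : ℕ) : ℤ) - 1 ∧ s = i k} ∧
        FCDiagram.rightDescents cs w =
            {s | ∃ k : Fin p, (k : ℕ) + 1 = p ∧ s = j k} ∪
            {s | ∃ k l : Fin p, (l : ℕ) = (k : ℕ) + 1 ∧
              ((j l : ℕ) : ℤ) + 1 < ((j k : ℕ) : ℤ) ∧ s = j k}) ∧
    -- descent sets from the diagram, which is non-crossing and can be computed from any
    -- reduced expression
    (∀ w : W, FCDiagram.IsFullyCommutative cs w →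
      FCDiagram.IsNonCrossingDiagram (FCDiagram.diagram cs w) ∧
      (∀ ω : List (Fin n), cs.IsReduced ω → cs.wordProd ω = w →
        FCDiagram.wordDiagram ω = FCDiagram.diagram cs w) ∧
      FCDiagram.leftDescents cs w =
        {s | (FCDiagram.top s.castSucc, FCDiagram.top s.succ) ∈
          FCDiagram.topArrows (FCDiagram.diagram cs w)} ∧
      FCDiagram.rightDescents cs w =
        {s | (FCDiagram.bot s.castSucc, FCDiagram.bot s.succ) ∈
          FCDiagram.bottomArrows (FCDiagram.diagram cs w)}) := by
  refine ⟨?_, ?_⟩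
  · rintro p i j h w rfl
    refine ⟨Set.ext fun s => ?_, Set.ext fun s => ?_⟩
    · exact (h.isAlternating.isLeftDescent_iff cs s).trans (h.precedes_iff s)
    · refine (h.isAlternating.isRightDescent_iff cs s).trans ?_
      exact h.precedes_reverse_iff s
  · intro w hw
    obtain ⟨hr, e⟩ := (cs.exists_isReduced w).choose_spec
    set ω := (cs.exists_isReduced w).choose with hω
    have ha : FCDiagram.IsAlternating (FCDiagram.intWord ω) := hw.isAlternating cs hr e.symm
    have hd : FCDiagram.diagram cs w = FCDiagram.arrows (FCDiagram.wordMatching ω) :=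
      FCDiagram.wordDiagram_eq ω
    have hm := FCDiagram.isMatching_wordMatching ω
    rw [hd]
    refine ⟨FCDiagram.isNonCrossingDiagram_arrows hm (FCDiagram.isPlanar_wordMatching ω),
      fun ω' hr' e' => ?_, Set.ext fun s => ?_, Set.ext fun s => ?_⟩
    · rw [FCDiagram.wordDiagram_eq,
        FCDiagram.wordMatching_eq_of_reflTransGen (hw _ _ hr' hr e' e.symm)]
    · refine Iff.trans (b := cs.IsLeftDescent w s) Iff.rfl ?_
      rw [e, ha.isLeftDescent_iff, ← ha.wordMatching_top_iff]
      exact ⟨fun h => ⟨⟨FCDiagram.top_lt_top.2 (by simp [Fin.lt_def]), h⟩, _, _, rfl⟩,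
        fun h => h.1.2⟩
    · refine Iff.trans (b := cs.IsRightDescent w s) Iff.rfl ?_
      rw [e, ha.isRightDescent_iff, ← FCDiagram.IsAlternating.wordMatching_top_iff
        (by rw [FCDiagram.intWord_reverse]; exact ha.reverse), FCDiagram.wordMatching_reverse]
      constructor
      · intro h
        refine ⟨⟨FCDiagram.bot_lt_bot.2 (by simp [Fin.lt_def]), ?_⟩, _, _, rfl⟩
        simpa using congrArg FCDiagram.flip h
      · intro h
        simpa using congrArg FCDiagram.flip h.1.2
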